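/- Let $d>0$ be a real constant and let $r\ge 2$ be a fixed integer. For $n\ge d$ let $G_{n,p}$ with $p=d/n$ be the binomial random graph on the vertex set $[n]=\{1,\dots,n\}$, in which each of the $\binom n2$ pairs of vertices is an edge independently with probability $p$. For a graph $G$ and an integer $k\ge 1$ let $G^k$ be the $k$th power of $G$: the graph on the same vertex set in which two distinct vertices are adjacent if and only if they are connected in $G$ by a path with at most $k$ edges. Let $\Delta$ denote the maximum degree and $\chi$ the chromatic number of a graph. Then $$\lim_{n\to\infty}\mathbb P\left(\Delta\big(G_{n,p}^{\lfloor r/2\rfloor}\big)\le \chi\big(G_{n,p}^r\big)\le \Delta\big(G_{n,p}^{r-1}\big)+1\right)=1.$$ -/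

import Mathlib

/-- The `r`th power of a graph `G`: two distinct vertices are adjacent when they are joined in `G`
by a walk (equivalently, by a path, see `graphPower_adj_iff_path`) with at most `r` edges, i.e. when
they are at distance at most `r` in `G`. -/
def graphPower {V : Type*} (G : SimpleGraph V) (r : ℕ) : SimpleGraph V where
  Adj u v := u ≠ v ∧ ∃ w : G.Walk u v, w.length ≤ r
  symm := ⟨fun _ _ ⟨hne, w, hw⟩ => ⟨hne.symm, w.reverse, by simpa using hw⟩⟩
  loopless := ⟨fun _ h => h.1 rfl⟩

/-- Adjacency in the power, in terms of paths instead of walks. -/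
theorem graphPower_adj_iff_path {V : Type*} (G : SimpleGraph V) (r : ℕ) (u v : V) :
    (graphPower G r).Adj u v ↔ u ≠ v ∧ ∃ w : G.Walk u v, w.IsPath ∧ w.length ≤ r := by
  classical
  constructor
  · rintro ⟨hne, w, hw⟩
    exact ⟨hne, w.bypass, w.bypass_isPath, w.length_bypass_le_length.trans hw⟩
  · rintro ⟨hne, w, -, hw⟩
    exact ⟨hne, w, hw⟩

noncomputable instance graphPower.decidableAdj {V : Type*} (G : SimpleGraph V) (r : ℕ) :
    DecidableRel (graphPower G r).Adj :=
  Classical.decRel _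

/-!
The lower bound holds for every graph: the neighbours of a vertex in `G ^ ⌊r / 2⌋` form a clique
of `G ^ r` (`maxDegree_graphPower_half_le_chromaticNumber`).

For the upper bound, write `Δ` for the maximum degree of `G ^ (r - 1)` and colour `G ^ r` greedily.
It suffices that every nonempty set `S` of vertices has a member with at most `Δ` neighbours in `S`.
In a forest this is true of a vertex `v` of `S` at maximal distance from a root: its neighbours in
`G ^ r` that lie in `S` are all reached through the parent `u` of `v`, so they are among the
vertices other than `v` within distance `r - 1` of `u`. A random graph is not a forest, but only the
surroundings of the vertices of large degree have to be one. Fix a constant `D`. If some `v` in `S`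
has only vertices of degree less than `D` within distance less than `r`, then the ball of radius `r`
around `v` has at most `D ^ r` vertices, which is at most `Δ` with high probability because the
maximum degree of the random graph tends to infinity (`tendsto_measureReal_no_degreeGE`). Otherwise
`S`, together with all short paths between its members, lies in the subgraph `hubHull G D (2 * r)`
spanned by the vertices within distance `2 * r` of a vertex of degree at least `D`. So the theorem
reduces to this hull being a forest (`chromaticNumber_graphPower_le`), with probability at least
`1 - ε` if `D` is large in terms of `ε` alone (`exists_measureReal_hubHull_not_isAcyclic_le`).

If the hull has a cycle, take a shortest one, of length `l`. It is isometric in the hull, so a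
number `t ≥ l / s` (`s` depending on `r` only) of well-spaced vertices of the cycle can be joined
to vertices of large degree by short tails in such a way that the cycle, the tails and stars of size
`k` at the ends of the tails are all edge-disjoint (`exists_cycle_with_attachedStars`). Because of
edge-disjointness the expected number of these configurations is at most `d ^ l * δ ^ t`, where
`δ = O(d ^ k / k!)` bounds the expected number of tails with stars at a given place. The sum over
`l` is a geometric series, which is small when `k` is large.
-/

/-! ### Greedy colouring, and the lower bound -/

/-- Greedy colouring: if every nonempty set `S` of vertices has a member with at most `N` neighbours
in `S`, then `N + 1` colours suffice. -/
theorem colorable_of_forall_exists_few_neighbors {V : Type*} [Fintype V] (Γ : SimpleGraph V)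
    (N : ℕ) (h : ∀ S : Finset V, S.Nonempty →
      ∃ v ∈ S, ∃ T : Finset V, T.card ≤ N ∧ ∀ w ∈ S, Γ.Adj v w → w ∈ T) :
    Γ.Colorable (N + 1) := by
  classical
  have key : ∀ (m : ℕ) (S : Finset V), S.card = m →
      ∃ c : V → Fin (N + 1), ∀ u ∈ S, ∀ v ∈ S, Γ.Adj u v → c u ≠ c v := by
    intro m
    induction m with
    | zero =>
      intro S hS
      rw [Finset.card_eq_zero] at hS
      subst hS
      exact ⟨fun _ => 0, by simp⟩
    | succ m ih =>
      intro S hS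
      obtain ⟨v, hv, T, hT, hvT⟩ := h S (Finset.card_pos.1 (by omega))
      obtain ⟨c, hc⟩ := ih (S.erase v) (by rw [Finset.card_erase_of_mem hv]; omega)
      obtain ⟨a, ha⟩ : ∃ a : Fin (N + 1), a ∉ T.image c := by
        by_contra! hcon
        have h1 : (Finset.univ : Finset (Fin (N + 1))) ⊆ T.image c := fun a _ => hcon a
        have h2 := Finset.card_le_card h1
        have h3 := Finset.card_image_le (s := T) (f := c)
        rw [Finset.card_univ, Fintype.card_fin] at h2
        omega
      have hav : ∀ w ∈ S, Γ.Adj v w → a ≠ c w := fun w hw hadj e =>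
        ha (Finset.mem_image.2 ⟨w, hvT w hw hadj, e.symm⟩)
      refine ⟨Function.update c v a, fun u hu w hw hadj => ?_⟩
      by_cases huv : u = v
      · subst huv
        rw [Function.update_self, Function.update_of_ne hadj.ne']
        exact hav w hw hadj
      · rw [Function.update_of_ne huv]
        by_cases hwv : w = v
        · subst hwv
          rw [Function.update_self]
          exact (hav u hu hadj.symm).symm
        · rw [Function.update_of_ne hwv]
          exact hc u (Finset.mem_erase.2 ⟨huv, hu⟩) w (Finset.mem_erase.2 ⟨hwv, hw⟩) hadj
  obtain ⟨c, hc⟩ := key _ Finset.univ rfl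
  exact ⟨SimpleGraph.Coloring.mk c fun {u v} huv =>
    hc u (Finset.mem_univ _) v (Finset.mem_univ _) huv⟩

/-- The neighbours of a vertex in `G ^ (r / 2)` form a clique in `G ^ r`. -/
theorem maxDegree_graphPower_half_le_chromaticNumber {V : Type*} [Fintype V] (G : SimpleGraph V)
    (r : ℕ) :
    ((graphPower G (r / 2)).maxDegree : ℕ∞) ≤ (graphPower G r).chromaticNumber := by
  rcases isEmpty_or_nonempty V with hV | hV
  · simp [SimpleGraph.maxDegree]
  obtain ⟨v, hv⟩ := (graphPower G (r / 2)).exists_maximal_degree_vertex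
  rw [hv, ← SimpleGraph.card_neighborFinset_eq_degree]
  refine SimpleGraph.IsClique.card_le_chromaticNumber ?_
  intro a ha b hb hab
  simp only [Finset.mem_coe, SimpleGraph.mem_neighborFinset] at ha hb
  obtain ⟨-, p, hp⟩ := ha
  obtain ⟨-, q, hq⟩ := hb
  refine ⟨hab, p.reverse.append q, ?_⟩
  rw [SimpleGraph.Walk.length_append, SimpleGraph.Walk.length_reverse]
  omega

/-! ### Vertices of large degree and their neighbourhoods -/

/-- `v` has degree at least `k` in `G`. -/
def DegreeGE {V : Type*} (G : SimpleGraph V) (k : ℕ) (v : V) : Prop :=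
  ∃ L : Finset V, L.card = k ∧ ∀ l ∈ L, G.Adj v l

/-- If no vertex within distance less than `r` of `v` has degree `D` or more, then the ball of
radius `r` around `v` has at most `D ^ r` vertices. -/
theorem card_ball_le {V : Type*} [Fintype V] (G : SimpleGraph V) (D : ℕ) (v : V) (r : ℕ)
    (h : ∀ x, (∃ p : G.Walk v x, p.length < r) → ¬ DegreeGE G D x) :
    ∃ B : Finset V, B.card ≤ D ^ r ∧ ∀ w, (∃ p : G.Walk v w, p.length ≤ r) → w ∈ B := by
  classical
  induction r with
  | zero =>
    refine ⟨{v}, by simp, ?_⟩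
    rintro w ⟨p, hp⟩
    rw [Finset.mem_singleton]
    exact (SimpleGraph.Walk.eq_of_length_eq_zero (Nat.le_zero.1 hp)).symm
  | succ r ih =>
    obtain ⟨B, hB, hBmem⟩ := ih fun x ⟨p, hp⟩ => h x ⟨p, by omega⟩
    refine ⟨(B.filter fun x => ∃ p : G.Walk v x, p.length ≤ r).biUnion
      fun x => insert x (G.neighborFinset x), ?_, ?_⟩
    · refine (Finset.card_biUnion_le_card_mul _ _ D fun x hx => ?_).trans ?_
      · obtain ⟨-, p, hp⟩ := Finset.mem_filter.1 hx
        have h1 := h x ⟨p, by omega⟩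
        by_contra! h2
        apply h1
        have h3 := Finset.card_insert_le x (G.neighborFinset x)
        obtain ⟨L, hL, hLc⟩ := Finset.exists_subset_card_eq
          (show D ≤ (G.neighborFinset x).card by omega)
        exact ⟨L, hLc, fun l hl => by simpa using hL hl⟩
      · rw [pow_succ]
        exact Nat.mul_le_mul_right _ ((Finset.card_filter_le _ _).trans hB)
    · rintro w ⟨p, hp⟩
      rw [Finset.mem_biUnion]
      by_cases hpr : p.length ≤ r
      · exact ⟨w, Finset.mem_filter.2 ⟨hBmem w ⟨p, hpr⟩, p, hpr⟩, Finset.mem_insert_self _ _⟩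
      · have hlen : p.length = r + 1 := by omega
        have hq : ∃ q : G.Walk v (p.getVert r), q.length ≤ r :=
          ⟨p.take r, by rw [SimpleGraph.Walk.take_length]; exact min_le_left _ _⟩
        refine ⟨p.getVert r, Finset.mem_filter.2 ⟨hBmem _ hq, hq⟩, Finset.mem_insert_of_mem ?_⟩
        rw [SimpleGraph.mem_neighborFinset]
        have := p.adj_getVert_succ (i := r) (by omega)
        rwa [← hlen, p.getVert_length] at this

/-- The subgraph of `G` spanned by the vertices at distance at most `R` from some vertex of degree
at least `k`; the other vertices are kept as isolated vertices. -/
def hubHull {V : Type*} (G : SimpleGraph V) (k R : ℕ) : SimpleGraph V where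
  Adj u v := G.Adj u v ∧ (∃ h, DegreeGE G k h ∧ ∃ p : G.Walk u h, p.length ≤ R) ∧
    ∃ h, DegreeGE G k h ∧ ∃ p : G.Walk v h, p.length ≤ R
  symm := ⟨fun _ _ ⟨h, hu, hv⟩ => ⟨h.symm, hv, hu⟩⟩
  loopless := ⟨fun _ h => h.1.ne rfl⟩

theorem hubHull_le {V : Type*} (G : SimpleGraph V) (k R : ℕ) : hubHull G k R ≤ G :=
  fun _ _ h => h.1

/-- A walk of `G` all of whose vertices are close to a vertex of large degree is a walk of the
hull. -/
theorem exists_walk_hubHull {V : Type*} {G : SimpleGraph V} {k R : ℕ} {u v : V} (p : G.Walk u v)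
    (hp : ∀ x ∈ p.support, ∃ h, DegreeGE G k h ∧ ∃ q : G.Walk x h, q.length ≤ R) :
    ∃ q : (hubHull G k R).Walk u v, q.length = p.length := by
  refine ⟨p.transfer _ fun e he => ?_, p.length_transfer _⟩
  induction e with
  | h x y =>
    exact ⟨p.adj_of_mem_edges he, hp x (p.fst_mem_support_of_mem_edges he),
      hp y (p.snd_mem_support_of_mem_edges he)⟩

/-- Every vertex with an edge in the hull is close, within the hull, to a vertex whose degree in the
hull is large. -/
theorem exists_degreeGE_hubHull {V : Type*} {G : SimpleGraph V} {k R : ℕ} (hR : 1 ≤ R) {u v : V}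
    (huv : (hubHull G k R).Adj u v) :
    ∃ h, DegreeGE (hubHull G k R) k h ∧ ∃ p : (hubHull G k R).Walk u h, p.length ≤ R := by
  classical
  obtain ⟨-, ⟨h, hh, p, hp⟩, -⟩ := huv
  refine ⟨h, ?_, ?_⟩
  · obtain ⟨L, hL, hLadj⟩ := hh
    exact ⟨L, hL, fun l hl => ⟨hLadj l hl, ⟨h, ⟨L, hL, hLadj⟩, .nil, by simp⟩,
      ⟨h, ⟨L, hL, hLadj⟩, (hLadj l hl).symm.toWalk, by simpa using hR⟩⟩⟩
  · obtain ⟨q, hq⟩ := exists_walk_hubHull (k := k) (R := R) p fun x hx =>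
      ⟨h, hh, p.dropUntil x hx, (p.length_dropUntil_le_length hx).trans hp⟩
    exact ⟨q, by omega⟩

/-! ### Powers of a forest -/

/-- In a forest rooted at `a`, any path leaving `v` towards a vertex that is no farther from the
root than `v` starts with the edge to the parent of `v`. -/
theorem snd_eq_penultimate_of_isAcyclic {V : Type*} {F : SimpleGraph V} (hF : F.IsAcyclic)
    {a v w : V} {p : F.Walk a v} (hp : p.IsPath) {q : F.Walk v w} (hq : q.IsPath) (hvw : v ≠ w)
    (hdist : F.dist a w ≤ p.length) : a ≠ v ∧ q.snd = p.penultimate := by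
  have hav : a ≠ v := by
    rintro rfl
    have h0 : p.length = 0 := SimpleGraph.Walk.length_eq_zero_iff.2
      (SimpleGraph.Walk.isPath_iff_nil.1 hp)
    rw [h0, Nat.le_zero, SimpleGraph.Reachable.dist_eq_zero_iff ⟨q⟩] at hdist
    exact hvw hdist
  refine ⟨hav, ?_⟩
  by_contra hne
  have hqn : ¬ q.Nil := SimpleGraph.Walk.not_nil_of_ne hvw
  have hpn : ¬ p.Nil := SimpleGraph.Walk.not_nil_of_ne hav
  have hpath : (p.append q).IsPath := by
    rw [hF.isPath_iff_isChain, SimpleGraph.Walk.edges_append, List.isChain_append]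
    refine ⟨(hF.isPath_iff_isChain p).1 hp, (hF.isPath_iff_isChain q).1 hq, ?_⟩
    rw [← SimpleGraph.Walk.cons_tail_eq q hqn,
      ← SimpleGraph.Walk.concat_dropLast (p.adj_penultimate hpn)]
    intro x hx y hy
    simp only [SimpleGraph.Walk.edges_concat, List.concat_eq_append, List.getLast?_append,
      List.getLast?_singleton, Option.mem_def,
      SimpleGraph.Walk.edges_cons, List.head?_cons, Option.some_or, Option.some.injEq] at hx hy
    subst hx hy
    intro he
    rw [Sym2.eq_swap, Sym2.eq_iff] at he
    rcases he with ⟨-, h⟩ | ⟨h, -⟩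
    · exact hne h.symm
    · exact (q.adj_snd hqn).ne h
  obtain ⟨s, hs, hsl⟩ := (SimpleGraph.Walk.reachable (p.append q)).exists_path_of_dist
  have h1 : (⟨s, hs⟩ : F.Path a w) = ⟨p.append q, hpath⟩ := (hF.subsingleton_path a w).elim _ _
  have h2 : s = p.append q := congrArg Subtype.val h1
  rw [← hsl, h2, SimpleGraph.Walk.length_append] at hdist
  exact hvw (SimpleGraph.Walk.eq_of_length_eq_zero (p := q) (by omega))

/-- If the part of `G` close to the vertices of degree at least `D` is a forest and `D ^ r` does not
exceed the maximum degree of `G ^ (r - 1)`, then greedy colouring of `G ^ r` succeeds: in a set of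
vertices either some ball of radius `r` is small, or all of them lie in the forest, where the
neighbours of a vertex farthest from the root all lie close to its parent. -/
theorem chromaticNumber_graphPower_le {V : Type*} [Fintype V] (G : SimpleGraph V)
    (r D : ℕ) (hr : 2 ≤ r) (hF : (hubHull G D (2 * r)).IsAcyclic)
    (hD : D ^ r ≤ (graphPower G (r - 1)).maxDegree) :
    (graphPower G r).chromaticNumber ≤ ((graphPower G (r - 1)).maxDegree : ℕ∞) + 1 := by
  classical
  set M := (graphPower G (r - 1)).maxDegree with hM
  suffices h : (graphPower G r).Colorable (M + 1) by
    have := h.chromaticNumber_le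
    exact_mod_cast this
  refine colorable_of_forall_exists_few_neighbors _ _ fun S hS => ?_
  set F := hubHull G D (2 * r) with hFdef
  -- Either some member of `S` has a small ball, or each one has a vertex of large degree nearby.
  by_cases hlight : ∃ v ∈ S, ∀ x, (∃ p : G.Walk v x, p.length < r) → ¬ DegreeGE G D x
  · obtain ⟨v, hv, hvx⟩ := hlight
    obtain ⟨B, hB, hBm⟩ := card_ball_le G D v r hvx
    exact ⟨v, hv, B, hB.trans hD, fun w _ hw => hBm w hw.2⟩
  push Not at hlight
  -- A short walk of `G` between two vertices of `S` is a walk of the forest.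
  have hwalk : ∀ v ∈ S, ∀ w, ∀ p : G.Walk v w, p.length ≤ r →
      ∃ q : F.Walk v w, q.length ≤ r := by
    intro v hv w p hp
    obtain ⟨h, ⟨s, hs⟩, hh⟩ := hlight v hv
    obtain ⟨q, hq⟩ := exists_walk_hubHull (k := D) (R := 2 * r) p fun x hx =>
      ⟨h, hh, (p.takeUntil x hx).reverse.append s, by
        have := p.length_takeUntil_le_length hx
        rw [SimpleGraph.Walk.length_append, SimpleGraph.Walk.length_reverse]
        omega⟩
    exact ⟨q, by omega⟩
  obtain ⟨a, ha⟩ := hS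
  obtain ⟨v, hv, hmax⟩ := (S.filter fun x => F.Reachable a x).exists_max_image (fun x => F.dist a x)
    ⟨a, Finset.mem_filter.2 ⟨ha, .refl _⟩⟩
  obtain ⟨hvS, hav⟩ := Finset.mem_filter.1 hv
  obtain ⟨p, hp, hpl⟩ := hav.exists_path_of_dist
  have hkey : ∀ w ∈ S, (graphPower G r).Adj v w → a ≠ v ∧
      ∃ q : F.Walk p.penultimate w, q.length ≤ r - 1 := by
    rintro w hw ⟨hvw, s, hs⟩
    obtain ⟨q, hq⟩ := hwalk v hvS w s hs
    have hq' := q.length_bypass_le_length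
    have h1 := hmax w (Finset.mem_filter.2 ⟨hw, hav.trans ⟨q⟩⟩)
    obtain ⟨h2, h3⟩ := snd_eq_penultimate_of_isAcyclic hF hp q.bypass_isPath hvw (h1.trans hpl.ge)
    refine ⟨h2, q.bypass.tail.copy h3 rfl, ?_⟩
    rw [SimpleGraph.Walk.length_copy]
    have := SimpleGraph.Walk.length_tail_add_one (SimpleGraph.Walk.not_nil_of_ne (p := q.bypass) hvw)
    omega
  by_cases hav' : a = v
  · exact ⟨v, hvS, ∅, by simp, fun w hw hadj => absurd hav' (hkey w hw hadj).1⟩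
  set u := p.penultimate with hu
  have huv : F.Adj u v := p.adj_penultimate (SimpleGraph.Walk.not_nil_of_ne hav')
  have hvmem : v ∈ (graphPower G (r - 1)).neighborFinset u := by
    rw [SimpleGraph.mem_neighborFinset]
    exact ⟨huv.ne, ((hubHull_le _ _ _) huv).toWalk, by simp; omega⟩
  refine ⟨v, hvS, insert u (((graphPower G (r - 1)).neighborFinset u).erase v), ?_, ?_⟩
  · refine (Finset.card_insert_le _ _).trans ?_
    rw [Finset.card_erase_of_mem hvmem, Nat.sub_add_cancel (Finset.card_pos.2 ⟨v, hvmem⟩),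
      SimpleGraph.card_neighborFinset_eq_degree]
    exact (graphPower G (r - 1)).degree_le_maxDegree u
  · intro w hw hadj
    obtain ⟨-, q, hq⟩ := hkey w hw hadj
    rw [Finset.mem_insert]
    by_cases hwu : w = u
    · exact .inl hwu
    · refine .inr (Finset.mem_erase.2 ⟨hadj.ne', ?_⟩)
      rw [SimpleGraph.mem_neighborFinset]
      exact ⟨fun h => hwu h.symm, q.mapLe (hubHull_le _ _ _), by simpa using hq⟩

/-! ### Shortest cycles -/

/-- Two distinct paths with the same ends span a cycle: the graph formed by their edges violates
uniqueness of paths, and a cycle in it uses each of these edges at most once. -/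
theorem exists_isCycle_of_isPath_ne {V : Type*} {F : SimpleGraph V} {u v : V} {p q : F.Walk u v}
    (hp : p.IsPath) (hq : q.IsPath) (hne : p ≠ q) :
    ∃ (a : V) (w : F.Walk a a), w.IsCycle ∧ w.length ≤ p.length + q.length := by
  classical
  set H : SimpleGraph V := SimpleGraph.fromEdgeSet {e | e ∈ p.edges ∨ e ∈ q.edges} with hH
  have hHF : H ≤ F := by
    intro x y hxy
    rcases (SimpleGraph.fromEdgeSet_adj _).1 hxy with ⟨h | h, -⟩
    · exact p.adj_of_mem_edges h
    · exact q.adj_of_mem_edges h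
  have hpe : ∀ e ∈ p.edges, e ∈ H.edgeSet := fun e he => by
    rw [hH, SimpleGraph.edgeSet_fromEdgeSet]
    exact ⟨.inl he, F.not_isDiag_of_mem_edgeSet (p.edges_subset_edgeSet he)⟩
  have hqe : ∀ e ∈ q.edges, e ∈ H.edgeSet := fun e he => by
    rw [hH, SimpleGraph.edgeSet_fromEdgeSet]
    exact ⟨.inr he, F.not_isDiag_of_mem_edgeSet (q.edges_subset_edgeSet he)⟩
  have hcyc : ¬ H.IsAcyclic := by
    intro hac
    have h1 : (⟨p.transfer H hpe, hp.transfer hpe⟩ : H.Path u v) =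
        ⟨q.transfer H hqe, hq.transfer hqe⟩ := (hac.subsingleton_path u v).elim _ _
    have h2 := congrArg SimpleGraph.Walk.support (congrArg Subtype.val h1)
    simp only [SimpleGraph.Walk.support_transfer] at h2
    exact hne (SimpleGraph.Walk.ext_support h2)
  simp only [SimpleGraph.IsAcyclic, not_forall, not_not] at hcyc
  obtain ⟨a, w, hw⟩ := hcyc
  refine ⟨a, w.mapLe hHF, hw.mapLe hHF, ?_⟩
  rw [SimpleGraph.Walk.length_map, ← w.length_edges,
    ← List.toFinset_card_of_nodup hw.edges_nodup]
  have hsub : w.edges.toFinset ⊆ p.edges.toFinset ∪ q.edges.toFinset := by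
    intro e he
    have h1 := w.edges_subset_edgeSet (List.mem_toFinset.1 he)
    rw [hH, SimpleGraph.edgeSet_fromEdgeSet] at h1
    simpa using h1.1
  refine (Finset.card_le_card hsub).trans ((Finset.card_union_le _ _).trans ?_)
  refine Nat.add_le_add ?_ ?_
  · exact (List.toFinset_card_le _).trans p.length_edges.le
  · exact (List.toFinset_card_le _).trans q.length_edges.le

/-- `c` runs periodically around a cycle of `F` of length `l`, and `F` has no shorter cycle. -/
structure IsShortestCycle {V : Type*} (F : SimpleGraph V) (l : ℕ) (c : ℕ → V) : Prop where
  three_le : 3 ≤ l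
  adj : ∀ i, F.Adj (c i) (c (i + 1))
  eq_iff : ∀ i j, c i = c j ↔ i ≡ j [MOD l]
  le_length : ∀ (a : V) (w : F.Walk a a), w.IsCycle → l ≤ w.length

theorem exists_isShortestCycle {V : Type*} {F : SimpleGraph V} (hF : ¬ F.IsAcyclic) :
    ∃ l c, IsShortestCycle F l c := by
  obtain ⟨a, w, hw, hmin⟩ := SimpleGraph.exists_egirth_eq_length.2 hF
  have h3 := hw.three_le_length
  have hlt : ∀ i, i % w.length < w.length := fun i => Nat.mod_lt _ (by omega)
  refine ⟨w.length, fun i => w.getVert (i % w.length), h3, fun i => ?_, fun i j => ?_, ?_⟩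
  · have h1 := w.adj_getVert_succ (hlt i)
    rcases Nat.lt_or_ge (i % w.length + 1) w.length with h | h
    · rwa [show (i + 1) % w.length = i % w.length + 1 by
        rw [Nat.add_mod, Nat.mod_eq_of_lt (show 1 < w.length by omega), Nat.mod_eq_of_lt h]]
    · have h2 : i % w.length + 1 = w.length := by have := hlt i; omega
      have h4 : (i + 1) % w.length = 0 := by
        rw [Nat.add_mod, Nat.mod_eq_of_lt (show 1 < w.length by omega), h2, Nat.mod_self]
      rw [h2, w.getVert_length] at h1
      rwa [h4, w.getVert_zero]
  · refine ⟨fun h => ?_, fun h => by rw [show i % w.length = j % w.length from h]⟩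
    exact hw.getVert_injOn' (by have := hlt i; simp; omega) (by have := hlt j; simp; omega) h
  · intro b v hv
    have h1 := SimpleGraph.egirth_le_length hv
    rw [hmin] at h1
    exact_mod_cast h1

namespace IsShortestCycle

variable {V : Type*} {F : SimpleGraph V} {l : ℕ} {c : ℕ → V}

theorem exists_arc (h : IsShortestCycle F l c) (i m : ℕ) :
    ∃ p : F.Walk (c i) (c (i + m)),
      p.length = m ∧ p.support = (List.range (m + 1)).map fun t => c (i + t) := by
  induction m with
  | zero => exact ⟨.nil, rfl, by simp⟩
  | succ m ih =>
    obtain ⟨p, hp, hs⟩ := ih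
    refine ⟨p.concat (h.adj (i + m)), by simp [hp], ?_⟩
    rw [SimpleGraph.Walk.support_concat, hs, List.range_succ (n := m + 1)]
    simp

/-- A shortest cycle is isometric: a walk shorter than a shortest arc between its ends would, together
with that arc, span a shorter cycle. -/
theorem le_length_of_walk (h : IsShortestCycle F l c) {i m : ℕ} (hm : 2 * m ≤ l)
    (q : F.Walk (c i) (c (i + m))) : m ≤ q.length := by
  classical
  by_contra! hlt
  obtain ⟨p, hp, hs⟩ := h.exists_arc i m
  have hpath : p.IsPath := by
    rw [SimpleGraph.Walk.isPath_def, hs]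
    refine List.Nodup.map_on (fun x hx y hy hxy => ?_) List.nodup_range
    rw [List.mem_range] at hx hy
    have h1 := Nat.ModEq.add_left_cancel' i ((h.eq_iff _ _).1 hxy)
    exact Nat.ModEq.eq_of_lt_of_lt h1 (by have := h.three_le; omega) (by have := h.three_le; omega)
  have hq := q.length_bypass_le_length
  have hne : p ≠ q.bypass := by
    intro he
    have := congrArg SimpleGraph.Walk.length he
    omega
  obtain ⟨a, w, hw, hwl⟩ := exists_isCycle_of_isPath_ne hpath q.bypass_isPath hne
  have := h.le_length a w hw
  omega

/-- The distance along a shortest cycle between the ends of a walk is at most the length of the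
walk. -/
theorem exists_modEq_of_walk (h : IsShortestCycle F l c) {i j : ℕ} (q : F.Walk (c i) (c j)) :
    ∃ m ≤ q.length, j ≡ i + m [MOD l] ∨ i ≡ j + m [MOD l] := by
  have h3 := h.three_le
  have hl : i % l < l := Nat.mod_lt _ (by omega)
  have hdiv := Nat.div_add_mod i l
  set d := (j + (l - i % l)) % l with hd
  have hdl : d < l := Nat.mod_lt _ (by omega)
  have h1 : j ≡ i + d [MOD l] := by
    have e1 : i + d ≡ i + (j + (l - i % l)) [MOD l] := Nat.ModEq.add_left _ (Nat.mod_modEq _ _)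
    have e2 : i + (j + (l - i % l)) = j + l * (i / l + 1) := by
      rw [mul_add, mul_one]; omega
    rw [e2] at e1
    exact (e1.trans (by simp [Nat.ModEq])).symm
  rcases Nat.le_total (2 * d) l with h2 | h2
  · refine ⟨d, ?_, .inl h1⟩
    have := h.le_length_of_walk h2 (q.copy rfl ((h.eq_iff _ _).2 h1))
    simpa using this
  · have h4 : i ≡ j + (l - d) [MOD l] := by
      have e1 := h1.add_right (l - d)
      rw [show i + d + (l - d) = i + l by omega] at e1
      exact (e1.trans (by simp [Nat.ModEq])).symm
    refine ⟨l - d, ?_, .inr h4⟩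
    have := h.le_length_of_walk (m := l - d) (by omega) (q.reverse.copy rfl ((h.eq_iff _ _).2 h4))
    simpa using this

end IsShortestCycle

/-! ### Stars attached to a cycle by edge-disjoint tails -/

/-- The edge sets consisting of a trail of length `j` starting at `a`, followed by a star with `k`
edges at its other end, all `j + k` edges being distinct. -/
def tailStars {V : Type*} [Fintype V] [DecidableEq V] (k : ℕ) : ℕ → V → Finset (Finset (Sym2 V))
  | 0, a => (Finset.univ.powersetCard k).image fun L => L.image fun l => s(a, l)
  | j + 1, a => Finset.univ.biUnion fun b =>
      ((tailStars k j b).filter fun E => s(a, b) ∉ E).image fun E => insert s(a, b) E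

/-- The tails of length at most `R` with a star at the end that start at one of the vertices
`c i, …, c (i + 2 * R)`. -/
def attachedStars {V : Type*} [Fintype V] [DecidableEq V] (k R : ℕ) (c : ℕ → V) (i : ℕ) :
    Finset (Finset (Sym2 V)) :=
  (Finset.range (2 * R + 1)).biUnion fun o =>
    (Finset.range (R + 1)).biUnion fun j => tailStars k j (c (i + o))

/-- The edges of the closed walk `c 0, c 1, …, c l = c 0`. -/
def cycleEdges {V : Type*} [DecidableEq V] (c : ℕ → V) (l : ℕ) : Finset (Sym2 V) :=
  (Finset.range l).image fun i => s(c i, c (i + 1))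

/-- A trail followed by a star none of whose edges lies on the trail. -/
theorem union_mem_tailStars {V : Type*} [Fintype V] [DecidableEq V] {F : SimpleGraph V} {a h : V}
    (q : F.Walk a h) (hq : q.IsTrail) (L : Finset V) (hL : ∀ x ∈ L, s(h, x) ∉ q.edges) :
    q.edges.toFinset ∪ L.image (fun x => s(h, x)) ∈ tailStars L.card q.length a := by
  induction q with
  | nil =>
    simp only [SimpleGraph.Walk.edges_nil, List.toFinset_nil, Finset.empty_union,
      SimpleGraph.Walk.length_nil, tailStars, Finset.mem_image, Finset.mem_powersetCard]
    exact ⟨L, ⟨Finset.subset_univ _, rfl⟩, rfl⟩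
  | @cons u v w huv q ih =>
    rw [SimpleGraph.Walk.isTrail_cons] at hq
    simp only [SimpleGraph.Walk.edges_cons, List.mem_cons, not_or] at hL
    have h1 := ih hq.1 fun x hx => (hL x hx).2
    simp only [SimpleGraph.Walk.length_cons, tailStars, Finset.mem_biUnion, Finset.mem_univ,
      true_and, Finset.mem_image, Finset.mem_filter]
    refine ⟨v, _, ⟨h1, ?_⟩, ?_⟩
    · simp only [Finset.mem_union, List.mem_toFinset, Finset.mem_image, not_or]
      exact ⟨hq.2, fun ⟨x, hx, he⟩ => (hL x hx).1 he⟩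
    · rw [SimpleGraph.Walk.edges_cons, List.toFinset_cons, Finset.insert_union]

namespace IsShortestCycle

variable {V : Type*} {F : SimpleGraph V} {l : ℕ} {c : ℕ → V}

theorem exists_eq_of_mem_cycleEdges [DecidableEq V] (h : IsShortestCycle F l c) {t : ℕ} {x : V}
    (hx : s(c t, x) ∈ cycleEdges c l) : x = c (t + 1) ∨ x = c (t + (l - 1)) := by
  have h3 := h.three_le
  obtain ⟨i, -, hi⟩ := Finset.mem_image.1 hx
  rcases Sym2.eq_iff.1 hi with ⟨h1, h2⟩ | ⟨h1, h2⟩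
  · left
    rw [← h2, h.eq_iff]
    exact ((h.eq_iff _ _).1 h1).add_right 1
  · right
    rw [← h1, h.eq_iff]
    have e1 := ((h.eq_iff _ _).1 h2).add_right (l - 1)
    rw [show i + 1 + (l - 1) = i + l by omega] at e1
    exact (show i ≡ i + l [MOD l] by simp [Nat.ModEq]).trans e1

theorem cycleEdges_subset [DecidableEq V] (h : IsShortestCycle F l c) {e : Sym2 V}
    (he : e ∈ cycleEdges c l) : e ∈ F.edgeSet := by
  obtain ⟨i, -, rfl⟩ := Finset.mem_image.1 he
  exact h.adj i

theorem exists_eq_of_mem_of_mem_cycleEdges [DecidableEq V] {e : Sym2 V}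
    (he : e ∈ cycleEdges c l) {x : V} (hx : x ∈ e) : ∃ t, x = c t := by
  obtain ⟨i, -, rfl⟩ := Finset.mem_image.1 he
  rcases Sym2.mem_iff.1 hx with h1 | h1
  exacts [⟨_, h1⟩, ⟨_, h1⟩]

/-- A walk from the cycle to a vertex `h` of large degree yields, after its last visit to the cycle,
a tail which together with a star at `h` is edge-disjoint from the cycle. As the cycle is
isometric, the tail starts close to where the walk does. -/
theorem exists_mem_attachedStars [Fintype V] [DecidableEq V] (hc : IsShortestCycle F l c)
    {k R i : ℕ} {h : V} (p : F.Walk (c (i + R)) h) (hp : p.length ≤ R)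
    (hh : DegreeGE F (k + R + 2) h) :
    ∃ E ∈ attachedStars k R c i, Disjoint E (cycleEdges c l) ∧ (∀ e ∈ E, e ∈ F.edgeSet) ∧
      ∀ e ∈ E, ∀ x ∈ e, ∃ q : F.Walk (c (i + R)) x, q.length ≤ R + 1 := by
  classical
  have hex : ∃ m, ∃ b, ∃ q₁ : F.Walk (c (i + R)) (c b), ∃ q₂ : F.Walk (c b) h,
      q₁.length + q₂.length ≤ R ∧ q₂.length = m :=
    ⟨p.length, i + R, .nil, p, by simpa using hp, rfl⟩
  obtain ⟨b, q₁, q₀, hlen, hmin⟩ := Nat.find_spec hex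
  have hmin' : ∀ (b : ℕ) (q₁ : F.Walk (c (i + R)) (c b)) (q₂ : F.Walk (c b) h),
      q₁.length + q₂.length ≤ R → q₀.length ≤ q₂.length := fun b q₁ q₂ h12 => by
    rw [hmin]; exact Nat.find_min' hex ⟨b, q₁, q₂, h12, rfl⟩
  clear hmin
  obtain ⟨q, hq, hql⟩ : ∃ q : F.Walk (c b) h, q.IsPath ∧ q.length ≤ q₀.length :=
    ⟨q₀.bypass, q₀.bypass_isPath, q₀.length_bypass_le_length⟩
  -- By minimality, the tail meets the cycle in its first vertex only.
  have honly : ∀ t, c t ∈ q.support → c t = c b := by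
    intro t ht
    by_contra hne
    have h1 : (q.takeUntil _ ht).length + (q.dropUntil _ ht).length = q.length := by
      rw [← SimpleGraph.Walk.length_append, SimpleGraph.Walk.take_spec]
    have h2 : (q.takeUntil _ ht).length ≠ 0 := fun h0 =>
      hne (SimpleGraph.Walk.eq_of_length_eq_zero h0).symm
    have h4 := hmin' t (q₁.append (q.takeUntil _ ht)) (q.dropUntil _ ht) (by
      rw [SimpleGraph.Walk.length_append]; omega)
    omega
  obtain ⟨o, ho, hbo⟩ : ∃ o < 2 * R + 1, c b = c (i + o) := by
    obtain ⟨m, hm, h1 | h1⟩ := hc.exists_modEq_of_walk q₁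
    · exact ⟨R + m, by omega, (hc.eq_iff _ _).2 (by rwa [← add_assoc])⟩
    · refine ⟨R - m, by omega, (hc.eq_iff _ _).2 ?_⟩
      rw [show i + R = i + (R - m) + m by omega] at h1
      exact (Nat.ModEq.add_right_cancel' m h1).symm
  obtain ⟨L₀, hL₀, hadj⟩ := hh
  have hinj : Function.Injective fun x : V => s(h, x) := fun x y hxy =>
    Sym2.congr_right.1 hxy
  -- Of the edges at `h`, at most `R` belong to the tail and at most two to the cycle, which leaves `k`
  -- for the star.
  have hbad₁ : (L₀.filter fun x => s(h, x) ∈ q.edges).card ≤ R := by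
    rw [← Finset.card_image_of_injective _ hinj]
    refine (Finset.card_le_card (t := q.edges.toFinset) ?_).trans
      ((List.toFinset_card_le _).trans ?_)
    · intro e he
      obtain ⟨x, hx, rfl⟩ := Finset.mem_image.1 he
      exact List.mem_toFinset.2 (Finset.mem_filter.1 hx).2
    · rw [SimpleGraph.Walk.length_edges]; omega
  have hbad₂ : (L₀.filter fun x => s(h, x) ∈ cycleEdges c l).card ≤ 2 := by
    by_cases hhc : ∃ t, h = c t
    · obtain ⟨t, rfl⟩ := hhc
      refine (Finset.card_le_card (t := {c (t + 1), c (t + (l - 1))}) ?_).trans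
        Finset.card_le_two
      intro x hx
      simpa using hc.exists_eq_of_mem_cycleEdges (Finset.mem_filter.1 hx).2
    · rw [Finset.filter_false_of_mem]
      · simp
      · exact fun x _ hx => hhc (exists_eq_of_mem_of_mem_cycleEdges hx (Sym2.mem_mk_left _ _))
  obtain ⟨L, hLsub, hLk⟩ : ∃ L ⊆ L₀.filter fun x => s(h, x) ∉ q.edges ∧ s(h, x) ∉ cycleEdges c l,
      L.card = k := by
    apply Finset.exists_subset_card_eq
    have hcov : L₀ ⊆ ((L₀.filter fun x => s(h, x) ∈ q.edges) ∪
        (L₀.filter fun x => s(h, x) ∈ cycleEdges c l)) ∪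
        L₀.filter fun x => s(h, x) ∉ q.edges ∧ s(h, x) ∉ cycleEdges c l := by
      intro x hx
      simp only [Finset.mem_union, Finset.mem_filter, hx, true_and]
      tauto
    have h1 := Finset.card_le_card hcov
    have h2 := Finset.card_union_le ((L₀.filter fun x => s(h, x) ∈ q.edges) ∪
        (L₀.filter fun x => s(h, x) ∈ cycleEdges c l))
        (L₀.filter fun x => s(h, x) ∉ q.edges ∧ s(h, x) ∉ cycleEdges c l)
    have h4 := Finset.card_union_le (L₀.filter fun x => s(h, x) ∈ q.edges)
        (L₀.filter fun x => s(h, x) ∈ cycleEdges c l)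
    omega
  have hL : ∀ x ∈ L, F.Adj h x ∧ s(h, x) ∉ q.edges ∧ s(h, x) ∉ cycleEdges c l := fun x hx =>
    ⟨hadj x (Finset.mem_filter.1 (hLsub hx)).1, (Finset.mem_filter.1 (hLsub hx)).2⟩
  refine ⟨q.edges.toFinset ∪ L.image (fun x => s(h, x)), ?_, ?_, ?_, ?_⟩
  · refine Finset.mem_biUnion.2 ⟨o, Finset.mem_range.2 ho, Finset.mem_biUnion.2
      ⟨q.length, Finset.mem_range.2 (by omega), ?_⟩⟩
    rw [← hbo, ← hLk]
    exact union_mem_tailStars q hq.isTrail L fun x hx => (hL x hx).2.1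
  · rw [Finset.disjoint_left]
    intro e he hec
    rcases Finset.mem_union.1 he with h1 | h1
    · rw [List.mem_toFinset] at h1
      have hmem : ∀ x ∈ e, x = c b := by
        intro x hx
        obtain ⟨t, rfl⟩ := exists_eq_of_mem_of_mem_cycleEdges hec hx
        exact honly t (q.mem_support_of_mem_edges h1 hx)
      have hadj' := hc.cycleEdges_subset hec
      induction e with
      | h x y =>
        refine F.ne_of_adj hadj' ?_
        rw [hmem x (Sym2.mem_mk_left _ _), hmem y (Sym2.mem_mk_right _ _)]
    · obtain ⟨x, hx, rfl⟩ := Finset.mem_image.1 h1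
      exact (hL x hx).2.2 hec
  · intro e he
    rcases Finset.mem_union.1 he with h1 | h1
    · exact q.edges_subset_edgeSet (List.mem_toFinset.1 h1)
    · obtain ⟨x, hx, rfl⟩ := Finset.mem_image.1 h1
      exact (hL x hx).1
  · intro e he x hx
    rcases Finset.mem_union.1 he with h1 | h1
    · have hxs := q.mem_support_of_mem_edges (List.mem_toFinset.1 h1) hx
      refine ⟨q₁.append (q.takeUntil x hxs), ?_⟩
      have := q.length_takeUntil_le_length hxs
      rw [SimpleGraph.Walk.length_append]
      omega
    · obtain ⟨y, hy, rfl⟩ := Finset.mem_image.1 h1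
      rcases Sym2.mem_iff.1 hx with rfl | rfl
      · exact ⟨q₁.append q, by rw [SimpleGraph.Walk.length_append]; omega⟩
      · exact ⟨(q₁.append q).concat (hL x hy).1, by
          rw [SimpleGraph.Walk.length_concat, SimpleGraph.Walk.length_append]; omega⟩

end IsShortestCycle

/-- If every vertex of `F` with a neighbour is at distance at most `R` from a vertex of large degree
and `F` has a cycle, then `F` contains a cycle, of length `l` say, with a number of stars
proportional to `l` attached to it by tails, all of these being edge-disjoint. -/
theorem exists_cycle_with_attachedStars {V : Type*} [Fintype V] [DecidableEq V] {F : SimpleGraph V}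
    {k R : ℕ} (hF : ¬ F.IsAcyclic)
    (hub : ∀ u v, F.Adj u v → ∃ h, DegreeGE F (k + R + 2) h ∧ ∃ p : F.Walk u h, p.length ≤ R) :
    ∃ l c, IsShortestCycle F l c ∧ ∃ E : Fin (l / (2 * (2 * R + 3)) + 1) → Finset (Sym2 V),
      (∀ i : Fin _, E i ∈ attachedStars k R c (i * (2 * R + 3))) ∧
      (∀ i, Disjoint (E i) (cycleEdges c l)) ∧
      (Pairwise fun i j => Disjoint (E i) (E j)) ∧ ∀ i, ∀ e ∈ E i, e ∈ F.edgeSet := by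
  obtain ⟨l, c, hc⟩ := exists_isShortestCycle hF
  have h3 := hc.three_le
  have hE : ∀ i : ℕ, ∃ E ∈ attachedStars k R c (i * (2 * R + 3)), Disjoint E (cycleEdges c l) ∧
      (∀ e ∈ E, e ∈ F.edgeSet) ∧
      ∀ e ∈ E, ∀ x ∈ e, ∃ q : F.Walk (c (i * (2 * R + 3) + R)) x, q.length ≤ R + 1 := by
    intro i
    obtain ⟨h, hh, p, hp⟩ := hub _ _ (hc.adj (i * (2 * R + 3) + R))
    exact hc.exists_mem_attachedStars p hp hh
  choose E hE₁ hE₂ hE₃ hE₄ using hE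
  refine ⟨l, c, hc, fun i => E i, fun i => hE₁ i, fun i => hE₂ i, ?_, fun i => hE₃ i⟩
  -- Every vertex of the `i`-th star is within distance `R + 1` of `c (i * s + R)`, so a common vertex
  -- of two stars gives a walk of length at most `2 * R + 2 < s` between their base points, which are
  -- at distance at least `s` along the cycle.
  set s := 2 * R + 3 with hs
  have hlt : ∀ i j : ℕ, i < j → j < l / (2 * s) + 1 → Disjoint (E i) (E j) := by
    intro i j hij hj
    have hl : (j - i) * s + s ≤ l := by
      have h1 : j * (2 * s) ≤ l :=
        (Nat.mul_le_mul_right _ (by omega)).trans (Nat.div_mul_le_self l _)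
      calc (j - i) * s + s = (j - i + 1) * s := by ring
        _ ≤ (2 * j) * s := Nat.mul_le_mul_right _ (by omega)
        _ = j * (2 * s) := by ring
        _ ≤ l := h1
    have hpos : s ≤ (j - i) * s := Nat.le_mul_of_pos_left _ (by omega)
    have hji : j * s = i * s + (j - i) * s := by
      rw [← add_mul]; congr 1; omega
    rw [Finset.disjoint_left]
    intro e hei hej
    obtain ⟨x, hx⟩ : ∃ x, x ∈ e := by
      induction e with
      | h x y => exact ⟨x, Sym2.mem_mk_left _ _⟩
    obtain ⟨p, hp⟩ := hE₄ i e hei x hx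
    obtain ⟨q, hq⟩ := hE₄ j e hej x hx
    obtain ⟨m, hm, h1⟩ := hc.exists_modEq_of_walk (p.append q.reverse)
    rw [SimpleGraph.Walk.length_append, SimpleGraph.Walk.length_reverse] at hm
    rw [hji] at h1
    rcases h1 with h1 | h1
    · have h2 : (i * s + R) + (j - i) * s ≡ (i * s + R) + m [MOD l] := by
        convert h1 using 1; ring
      have h4 := (Nat.ModEq.add_left_cancel' _ h2).eq_of_lt_of_lt (by omega) (by omega)
      omega
    · have h2 : (i * s + R) + 0 ≡ (i * s + R) + ((j - i) * s + m) [MOD l] := by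
        convert h1 using 1 <;> ring
      have h4 := (Nat.ModEq.add_left_cancel' _ h2).eq_of_lt_of_lt (by omega) (by omega)
      omega
  intro i j hij
  rcases Nat.lt_or_gt_of_ne (Fin.val_ne_of_ne hij) with h | h
  · exact hlt _ _ h j.2
  · exact (hlt _ _ h i.2).symm

/-! ### Independence of the edges of the binomial random graph -/

open MeasureTheory ProbabilityTheory in
/-- The events that `e` is an edge, for `e` in `Sym2 V`, are independent; those on the diagonal never
occur. -/
theorem iIndepFun_mem_edgeSet (V : Type*) [Finite V] (p : unitInterval) :
    iIndepFun (fun (e : Sym2 V) (G : SimpleGraph V) => e ∈ G.edgeSet)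
      (SimpleGraph.binomialRandom V p) := by
  classical
  rw [SimpleGraph.binomialRandom_eq_map, setBernoulli_eq_map,
    Measure.map_map (by fun_prop) (by fun_prop), iIndepFun_iff_measure_inter_preimage_eq_mul]
  set π := Measure.infinitePi fun e : Sym2 V =>
    unitInterval.toNNReal p • Measure.dirac (e ∈ (Sym2.diagSet : Set (Sym2 V))ᶜ) +
      unitInterval.toNNReal (unitInterval.symm p) • Measure.dirac False with hπ
  have h1 : iIndepFun (fun (e : Sym2 V) (ω : Sym2 V → Prop) => ω e ∧ ¬ e.IsDiag) π :=
    iIndepFun_infinitePi (X := fun (e : Sym2 V) (q : Prop) => q ∧ ¬ e.IsDiag)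
      (fun e => measurable_of_finite _)
  have hm : Measurable ((SimpleGraph.fromEdgeSet : Set (Sym2 V) → SimpleGraph V) ∘
      fun ω : Sym2 V → Prop => {e | ω e}) := by fun_prop
  have hmem : ∀ e : Sym2 V, Measurable fun G : SimpleGraph V => (e ∈ G.edgeSet : Prop) := by
    intro e; fun_prop
  have hcomp : ∀ (e : Sym2 V) (s : Set Prop),
      ((SimpleGraph.fromEdgeSet : Set (Sym2 V) → SimpleGraph V) ∘
        fun ω : Sym2 V → Prop => {e | ω e}) ⁻¹' ((fun G : SimpleGraph V => e ∈ G.edgeSet) ⁻¹' s) =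
      (fun ω : Sym2 V → Prop => ω e ∧ ¬ e.IsDiag) ⁻¹' s := by
    intro e s
    ext ω
    simp only [Set.mem_preimage, Function.comp_apply, SimpleGraph.edgeSet_fromEdgeSet]
    rfl
  intro S sets hsets
  rw [Measure.map_apply hm (Finset.measurableSet_biInter _ fun e he => hmem e (hsets e he)),
    Set.preimage_iInter₂]
  simp only [hcomp]
  rw [h1.measure_inter_preimage_eq_mul S hsets]
  refine Finset.prod_congr rfl fun e he => ?_
  rw [Measure.map_apply hm (hmem e (hsets e he)), hcomp]

open MeasureTheory ProbabilityTheory in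
theorem measureReal_mem_edgeSet {V : Type*} [Finite V] (p : unitInterval) {e : Sym2 V}
    (he : ¬ e.IsDiag) :
    (SimpleGraph.binomialRandom V p).real {G | e ∈ G.edgeSet} = p := by
  classical
  rw [SimpleGraph.binomialRandom_eq_map, setBernoulli_eq_map,
    Measure.map_map (by fun_prop) (by fun_prop), measureReal_def,
    Measure.map_apply (by fun_prop)
      ((show Measurable fun G : SimpleGraph V => (e ∈ G.edgeSet : Prop) by fun_prop).setOf)]
  have h1 : ((SimpleGraph.fromEdgeSet : Set (Sym2 V) → SimpleGraph V) ∘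
        fun ω : Sym2 V → Prop => {e | ω e}) ⁻¹' {G | e ∈ G.edgeSet} =
      (fun ω : Sym2 V → Prop => ω e) ⁻¹' {True} := by
    ext ω
    simp [he]
  have h2 := Measure.infinitePi_map_eval (X := fun _ : Sym2 V => Prop) (fun e : Sym2 V =>
    unitInterval.toNNReal p • Measure.dirac (e ∈ (Sym2.diagSet : Set (Sym2 V))ᶜ) +
      unitInterval.toNNReal (unitInterval.symm p) • Measure.dirac False) e
  rw [h1, ← Measure.map_apply (measurable_pi_apply e) (by simp)]
  erw [h2]
  simp [he]

/-- Whether a graph lies in `A` depends only on which of the edges in `E` it contains. -/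
def DeterminedBy {V : Type*} (A : Set (SimpleGraph V)) (E : Finset (Sym2 V)) : Prop :=
  ∀ G G' : SimpleGraph V, (∀ e ∈ E, e ∈ G.edgeSet ↔ e ∈ G'.edgeSet) → (G ∈ A ↔ G' ∈ A)

namespace DeterminedBy

variable {V : Type*} {A B : Set (SimpleGraph V)} {E E' : Finset (Sym2 V)}

theorem compl (h : DeterminedBy A E) : DeterminedBy Aᶜ E := fun G G' hG =>
  not_congr (h G G' hG)

theorem biInter [DecidableEq V] {ι : Type*} {A : ι → Set (SimpleGraph V)}
    {E : ι → Finset (Sym2 V)} (h : ∀ i, DeterminedBy (A i) (E i)) (s : Finset ι) :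
    DeterminedBy (⋂ i ∈ s, A i) (s.biUnion E) := by
  intro G G' hG
  simp only [Set.mem_iInter]
  exact forall₂_congr fun i hi =>
    h i G G' fun e he => hG e (Finset.mem_biUnion.2 ⟨i, hi, he⟩)

theorem eq_preimage (h : DeterminedBy A E) :
    A = (fun (G : SimpleGraph V) (e : E) => (e : Sym2 V) ∈ G.edgeSet) ⁻¹'
      ((fun (G : SimpleGraph V) (e : E) => (e : Sym2 V) ∈ G.edgeSet) '' A) := by
  refine Set.Subset.antisymm (Set.subset_preimage_image _ _) fun G hG => ?_
  obtain ⟨G', hG', he⟩ := hG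
  exact (h G' G fun e hE => by simpa using congrFun he ⟨e, hE⟩).1 hG'

theorem measurableSet (h : DeterminedBy A E) : MeasurableSet A := by
  rw [h.eq_preimage]
  have : Measurable fun (G : SimpleGraph V) (e : E) => ((e : Sym2 V) ∈ G.edgeSet : Prop) := by
    fun_prop
  exact this (Set.toFinite _).measurableSet

variable [Finite V] (p : unitInterval)

open MeasureTheory ProbabilityTheory in
theorem measureReal_inter (hA : DeterminedBy A E) (hB : DeterminedBy B E') (hE : Disjoint E E') :
    (SimpleGraph.binomialRandom V p).real (A ∩ B) =
      (SimpleGraph.binomialRandom V p).real A * (SimpleGraph.binomialRandom V p).real B := by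
  have h := (iIndepFun_mem_edgeSet V p).indepFun_finset E E' hE (fun e => by fun_prop)
  have h1 := h.measure_inter_preimage_eq_mul _ _
    (Set.toFinite ((fun (G : SimpleGraph V) (e : E) => (e : Sym2 V) ∈ G.edgeSet) '' A)).measurableSet
    (Set.toFinite ((fun (G : SimpleGraph V) (e : E') => (e : Sym2 V) ∈ G.edgeSet) '' B)).measurableSet
  rw [← hA.eq_preimage, ← hB.eq_preimage] at h1
  rw [measureReal_def, h1, ENNReal.toReal_mul]
  rfl

theorem measureReal_biInter {ι : Type*} {A : ι → Set (SimpleGraph V)}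
    {E : ι → Finset (Sym2 V)} (h : ∀ i, DeterminedBy (A i) (E i)) (s : Finset ι)
    (hE : (s : Set ι).PairwiseDisjoint E) :
    (SimpleGraph.binomialRandom V p).real (⋂ i ∈ s, A i) =
      ∏ i ∈ s, (SimpleGraph.binomialRandom V p).real (A i) := by
  classical
  induction s using Finset.induction_on with
  | empty => simp
  | insert i s hi ih =>
    rw [Finset.set_biInter_insert, Finset.prod_insert hi,
      (h i).measureReal_inter p (biInter h s), ih (hE.subset (by simp))]
    rw [Finset.disjoint_biUnion_right]
    exact fun j hj => hE (by simp) (by simp [hj]) (by rintro rfl; exact hi hj)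

end DeterminedBy

theorem determinedBy_mem_edgeSet {V : Type*} (e : Sym2 V) :
    DeterminedBy {G : SimpleGraph V | e ∈ G.edgeSet} {e} :=
  fun _ _ h => h e (Finset.mem_singleton_self e)

/-- This is an equality unless `E` contains a loop. -/
theorem measureReal_edges_subset_le {V : Type*} [Finite V] (p : unitInterval)
    (E : Finset (Sym2 V)) :
    (SimpleGraph.binomialRandom V p).real {G | ∀ e ∈ E, e ∈ G.edgeSet} ≤ (p : ℝ) ^ E.card := by
  have h1 : {G : SimpleGraph V | ∀ e ∈ E, e ∈ G.edgeSet} = ⋂ e ∈ E, {G | e ∈ G.edgeSet} := by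
    ext G; simp
  rw [h1, DeterminedBy.measureReal_biInter p determinedBy_mem_edgeSet E
    (fun x _ y _ hxy => Finset.disjoint_singleton.2 hxy), ← Finset.prod_const]
  refine Finset.prod_le_prod (fun _ _ => MeasureTheory.measureReal_nonneg) fun e _ => ?_
  by_cases he : e.IsDiag
  · have h2 : {G : SimpleGraph V | e ∈ G.edgeSet} = ∅ := by
      ext G
      simp only [Set.mem_ofPred_eq, Set.mem_empty_iff_false, iff_false]
      exact fun h => G.not_isDiag_of_mem_edgeSet h he
    rw [h2, MeasureTheory.measureReal_empty]
    exact p.2.1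
  · exact (measureReal_mem_edgeSet p he).le

theorem determinedBy_forall_notMem {V : Type*} (E : Finset (Sym2 V)) :
    DeterminedBy {G : SimpleGraph V | ∀ e ∈ E, e ∉ G.edgeSet} E :=
  fun _ _ h => forall₂_congr fun e he => not_congr (h e he)

theorem measureReal_forall_notMem {V : Type*} [Finite V] (p : unitInterval)
    {E : Finset (Sym2 V)} (hE : ∀ e ∈ E, ¬ e.IsDiag) :
    (SimpleGraph.binomialRandom V p).real {G | ∀ e ∈ E, e ∉ G.edgeSet} =
      (1 - p : ℝ) ^ E.card := by
  have h1 : {G : SimpleGraph V | ∀ e ∈ E, e ∉ G.edgeSet} = ⋂ e ∈ E, {G | e ∈ G.edgeSet}ᶜ := by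
    ext G; simp
  rw [h1, DeterminedBy.measureReal_biInter p (fun e => (determinedBy_mem_edgeSet e).compl) E
    (fun x _ y _ hxy => Finset.disjoint_singleton.2 hxy), ← Finset.prod_const]
  refine Finset.prod_congr rfl fun e he => ?_
  rw [MeasureTheory.probReal_compl_eq_one_sub (determinedBy_mem_edgeSet e).measurableSet,
    measureReal_mem_edgeSet p (hE e he)]

/-! ### Vertices of large degree exist -/

/-- Each of the vertices `φ (inl a)` is adjacent, independently of the other ones, to all of `K`
blocks of size `|β|` with probability `(1 - (1 - p) ^ |β|) ^ K`, and then has degree at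
least `K`. -/
theorem measureReal_no_degreeGE_le {V α β : Type*} [Finite V] [Fintype α] [Fintype β]
    (p : unitInterval) (K : ℕ) (φ : α ⊕ (Fin K × β) ↪ V) :
    (SimpleGraph.binomialRandom V p).real {G | ∀ v, ¬ DegreeGE G K v} ≤
      (1 - (1 - (1 - p : ℝ) ^ Fintype.card β) ^ K) ^ Fintype.card α := by
  classical
  set μ := SimpleGraph.binomialRandom V p with hμ
  let ed : α → Fin K → β → Sym2 V := fun a j i => s(φ (.inl a), φ (.inr (j, i)))
  have hed : ∀ {a a' j j' i i'}, ed a j i = ed a' j' i' → a = a' ∧ j = j' ∧ i = i' := by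
    intro a a' j j' i i' h
    rcases Sym2.eq_iff.1 h with ⟨h1, h2⟩ | ⟨h1, h2⟩
    · have h3 := φ.injective h1
      have h4 := φ.injective h2
      simp only [Sum.inl.injEq, Sum.inr.injEq, Prod.mk.injEq] at h3 h4
      exact ⟨h3, h4⟩
    · have h3 := φ.injective h1
      simp at h3
  have hdiag : ∀ a j i, ¬ (ed a j i).IsDiag := by
    intro a j i h
    have h3 := φ.injective (Sym2.mk_isDiag_iff.1 h)
    simp at h3
  let E : α → Fin K → Finset (Sym2 V) := fun a j => Finset.univ.image (ed a j)
  have hEmem : ∀ {a j e}, e ∈ E a j → ∃ i, ed a j i = e := by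
    intro a j e he
    obtain ⟨i, -, hi⟩ := Finset.mem_image.1 he
    exact ⟨i, hi⟩
  let B : α → Fin K → Set (SimpleGraph V) := fun a j => {G | ∀ e ∈ E a j, e ∉ G.edgeSet}ᶜ
  have hB : ∀ a j, DeterminedBy (B a j) (E a j) := fun a j =>
    (determinedBy_forall_notMem (E a j)).compl
  have hBprob : ∀ a j, μ.real (B a j) = 1 - (1 - p : ℝ) ^ Fintype.card β := by
    intro a j
    have hcard : (E a j).card = Fintype.card β := by
      rw [Finset.card_image_of_injective _ fun i i' h => (hed h).2.2, Finset.card_univ]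
    rw [MeasureTheory.probReal_compl_eq_one_sub (determinedBy_forall_notMem (E a j)).measurableSet,
      measureReal_forall_notMem p, hcard]
    intro e he
    obtain ⟨i, rfl⟩ := hEmem he
    exact hdiag a j i
  have hgood : ∀ a, DeterminedBy (⋂ j ∈ (Finset.univ : Finset (Fin K)), B a j)
      (Finset.univ.biUnion (E a)) := fun a => DeterminedBy.biInter (hB a) _
  have hgoodprob : ∀ a, μ.real (⋂ j ∈ (Finset.univ : Finset (Fin K)), B a j) =
      (1 - (1 - p : ℝ) ^ Fintype.card β) ^ K := by
    intro a
    rw [DeterminedBy.measureReal_biInter p (hB a), Finset.prod_congr rfl fun j _ => hBprob a j]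
    · simp
    · intro j _ j' _ hjj
      refine Finset.disjoint_left.2 fun e he he' => ?_
      obtain ⟨i, rfl⟩ := hEmem he
      obtain ⟨i', h⟩ := hEmem he'
      exact hjj (hed h).2.1.symm
  have hsub : {G : SimpleGraph V | ∀ v, ¬ DegreeGE G K v} ⊆ ⋂ a ∈ (Finset.univ : Finset α),
      (⋂ j ∈ (Finset.univ : Finset (Fin K)), B a j)ᶜ := by
    intro G hG
    simp only [Set.mem_iInter]
    intro a _ hmem
    simp only [Set.mem_iInter] at hmem
    have h1 : ∀ j, ∃ i, G.Adj (φ (.inl a)) (φ (.inr (j, i))) := by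
      intro j
      have h2 := hmem j (Finset.mem_univ _)
      simp only [B, Set.mem_compl_iff, Set.mem_ofPred_eq, not_forall, not_not] at h2
      obtain ⟨e, he, heG⟩ := h2
      obtain ⟨i, rfl⟩ := hEmem he
      exact ⟨i, heG⟩
    choose f hf using h1
    refine hG (φ (.inl a)) ⟨Finset.univ.image fun j => φ (.inr (j, f j)), ?_, ?_⟩
    · rw [Finset.card_image_of_injective, Finset.card_univ, Fintype.card_fin]
      intro j j' h
      have h3 := φ.injective h
      simp only [Sum.inr.injEq, Prod.mk.injEq] at h3
      exact h3.1
    · intro l hl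
      obtain ⟨j, -, rfl⟩ := Finset.mem_image.1 hl
      exact hf j
  refine (MeasureTheory.measureReal_mono hsub).trans ?_
  rw [DeterminedBy.measureReal_biInter p (fun a => (hgood a).compl)]
  · rw [Finset.prod_congr rfl fun a _ => by
      rw [MeasureTheory.probReal_compl_eq_one_sub (hgood a).measurableSet, hgoodprob a]]
    simp
  · intro a _ a' _ haa
    refine Finset.disjoint_left.2 fun e he he' => ?_
    obtain ⟨j, -, hj⟩ := Finset.mem_biUnion.1 he
    obtain ⟨j', -, hj'⟩ := Finset.mem_biUnion.1 he'
    obtain ⟨i, rfl⟩ := hEmem hj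
    obtain ⟨i', h⟩ := hEmem hj'
    exact haa (hed h).1.symm

open Filter in
/-- The maximum degree of the random graph tends to infinity in probability. -/
theorem tendsto_measureReal_no_degreeGE {d : ℝ} (hd : 0 < d) {p : ℕ → unitInterval}
    (hp : ∀ᶠ n : ℕ in atTop, (p n : ℝ) = d / n) {K : ℕ} (hK : 0 < K) :
    Tendsto (fun n : ℕ => (SimpleGraph.binomialRandom (Fin n) (p n)).real
      {G | ∀ v, ¬ DegreeGE G K v}) atTop (nhds 0) := by
  set θ : ℝ := 1 - Real.exp (-(d / (4 * K))) with hθ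
  have hK' : (0 : ℝ) < K := by exact_mod_cast hK
  have hθ0 : 0 < θ := by
    rw [hθ, sub_pos, Real.exp_lt_one_iff]
    exact neg_lt_zero.2 (by positivity)
  have hθ1 : θ ≤ 1 := by
    rw [hθ]; linarith [Real.exp_pos (-(d / (4 * K)))]
  have hlim : Tendsto (fun n : ℕ => (1 - θ ^ K) ^ (n / 2)) atTop (nhds 0) :=
    (tendsto_pow_atTop_nhds_zero_of_lt_one (sub_nonneg.2 (pow_le_one₀ hθ0.le hθ1))
      (by linarith [pow_pos hθ0 K])).comp (Nat.tendsto_div_const_atTop two_ne_zero)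
  refine squeeze_zero' (.of_forall fun n => MeasureTheory.measureReal_nonneg) ?_ hlim
  filter_upwards [hp, eventually_ge_atTop (2 * K)] with n hpn hn
  -- Half of the vertices are centres; the other half is cut into `K` blocks of size `b`.
  set b := n / (2 * K) with hb
  have hn0 : (0 : ℝ) < n := by exact_mod_cast (show 0 < n by omega)
  have hcard : Fintype.card (Fin (n / 2) ⊕ (Fin K × Fin b)) ≤ Fintype.card (Fin n) := by
    simp only [Fintype.card_sum, Fintype.card_prod, Fintype.card_fin]
    have h1 : 2 * K * b ≤ n := Nat.mul_div_le n (2 * K)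
    have h2 : 2 * K * b = 2 * (K * b) := by ring
    omega
  obtain ⟨φ⟩ := Function.Embedding.nonempty_of_card_le hcard
  refine (measureReal_no_degreeGE_le (p n) K φ).trans ?_
  simp only [Fintype.card_fin]
  have hbn : (n : ℝ) ≤ 4 * K * b := by
    have h1 : 1 ≤ b := (Nat.one_le_div_iff (by omega)).2 hn
    have h2 : n < 2 * K * b + 2 * K := by
      have := Nat.lt_mul_div_succ n (show 0 < 2 * K by omega)
      rwa [mul_add, mul_one] at this
    have h3 : n ≤ 4 * K * b := by nlinarith
    exact_mod_cast h3
  have hpow : (1 - p n : ℝ) ^ b ≤ Real.exp (-(d / (4 * K))) := by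
    have h1 : (1 - p n : ℝ) ≤ Real.exp (-(p n : ℝ)) := by
      linarith [Real.add_one_le_exp (-(p n : ℝ))]
    refine (pow_le_pow_left₀ (sub_nonneg.2 (p n).2.2) h1 b).trans ?_
    rw [← Real.exp_nat_mul, Real.exp_le_exp, hpn, mul_neg, neg_le_neg_iff, ← mul_div_assoc,
      div_le_div_iff₀ (by positivity) hn0]
    nlinarith
  have h0 : (0 : ℝ) ≤ (1 - p n : ℝ) ^ b := pow_nonneg (sub_nonneg.2 (p n).2.2) b
  have h2 : θ ^ K ≤ (1 - (1 - p n : ℝ) ^ b) ^ K := pow_le_pow_left₀ hθ0.le (by linarith) K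
  have h3 : (1 - (1 - p n : ℝ) ^ b) ^ K ≤ 1 :=
    pow_le_one₀ (by linarith) (by linarith)
  exact pow_le_pow_left₀ (by linarith) (by linarith) _

/-! ### The expected number of cycles with attached stars -/

theorem Finset.sum_image_le_of_forall_nonneg {ι κ : Type*} [DecidableEq κ] (s : Finset ι)
    (g : ι → κ) {f : κ → ℝ} (hf : ∀ x, 0 ≤ f x) : ∑ x ∈ s.image g, f x ≤ ∑ i ∈ s, f (g i) := by
  classical
  induction s using Finset.induction_on with
  | empty => simp
  | insert a s ha ih =>
    rw [Finset.image_insert, Finset.sum_insert ha]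
    by_cases h : g a ∈ s.image g
    · rw [Finset.insert_eq_of_mem h]
      linarith [hf (g a)]
    · rw [Finset.sum_insert h]
      linarith

theorem Finset.sum_biUnion_le_of_forall_nonneg {ι κ : Type*} [DecidableEq κ] (s : Finset ι)
    (t : ι → Finset κ) {f : κ → ℝ} (hf : ∀ x, 0 ≤ f x) :
    ∑ x ∈ s.biUnion t, f x ≤ ∑ i ∈ s, ∑ x ∈ t i, f x := by
  classical
  induction s using Finset.induction_on with
  | empty => simp
  | insert a s ha ih =>
    rw [Finset.biUnion_insert, Finset.sum_insert ha]
    have h1 := Finset.sum_union_inter (s₁ := t a) (s₂ := s.biUnion t) (f := f)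
    have h2 : 0 ≤ ∑ x ∈ t a ∩ s.biUnion t, f x := Finset.sum_nonneg fun x _ => hf x
    linarith

/-- With `x = p`, this bounds the expected number of tails of length `j` with a star of size `k`
that start at `a`. -/
theorem sum_tailStars_le {V : Type*} [Fintype V] [DecidableEq V] {x : ℝ} (hx : 0 ≤ x) (k j : ℕ)
    (a : V) : ∑ E ∈ tailStars k j a, x ^ E.card ≤
      (Fintype.card V * x) ^ j * ((Fintype.card V * x) ^ k / k.factorial) := by
  induction j generalizing a with
  | zero =>
    refine (Finset.sum_image_le_of_forall_nonneg _ _ fun E => pow_nonneg hx _).trans ?_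
    have h1 : ∀ L ∈ (Finset.univ : Finset V).powersetCard k,
        x ^ (L.image fun l => s(a, l)).card = x ^ k := by
      intro L hL
      rw [Finset.card_image_of_injective _ fun y z hyz => Sym2.congr_right.1 hyz,
        (Finset.mem_powersetCard.1 hL).2]
    rw [Finset.sum_congr rfl h1, Finset.sum_const, Finset.card_powersetCard, Finset.card_univ,
      nsmul_eq_mul, pow_zero, one_mul, mul_pow, mul_div_right_comm]
    exact mul_le_mul_of_nonneg_right (Nat.choose_le_pow_div k _) (pow_nonneg hx k)
  | succ j ih =>
    refine (Finset.sum_biUnion_le_of_forall_nonneg _ _ fun E => pow_nonneg hx _).trans ?_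
    set C : ℝ := (Fintype.card V * x) ^ j * ((Fintype.card V * x) ^ k / k.factorial) with hC
    have h1 : ∀ b ∈ (Finset.univ : Finset V), ∑ E ∈ ((tailStars k j b).filter fun E =>
        s(a, b) ∉ E).image (fun E => insert s(a, b) E), x ^ E.card ≤ x * C := by
      intro b _
      refine (Finset.sum_image_le_of_forall_nonneg _ _ fun E => pow_nonneg hx _).trans ?_
      have h2 : ∀ E ∈ (tailStars k j b).filter fun E => s(a, b) ∉ E,
          x ^ (insert s(a, b) E).card = x * x ^ E.card := fun E hE => by
        rw [Finset.card_insert_of_notMem (Finset.mem_filter.1 hE).2, pow_succ']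
      rw [Finset.sum_congr rfl h2, ← Finset.mul_sum]
      refine mul_le_mul_of_nonneg_left (le_trans ?_ (ih b)) hx
      exact Finset.sum_le_sum_of_subset_of_nonneg (Finset.filter_subset _ _)
        fun _ _ _ => pow_nonneg hx _
    refine (Finset.sum_le_sum h1).trans ?_
    rw [Finset.sum_const, Finset.card_univ, nsmul_eq_mul, hC, pow_succ']
    exact le_of_eq (by ring)

theorem sum_attachedStars_le {V : Type*} [Fintype V] [DecidableEq V] {x : ℝ} (hx : 0 ≤ x)
    (k R : ℕ) (c : ℕ → V) (i : ℕ) : ∑ E ∈ attachedStars k R c i, x ^ E.card ≤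
      (2 * R + 1) * (∑ j ∈ Finset.range (R + 1), (Fintype.card V * x) ^ j) *
        ((Fintype.card V * x) ^ k / k.factorial) := by
  refine (Finset.sum_biUnion_le_of_forall_nonneg _ _ fun E => pow_nonneg hx _).trans ?_
  have h1 : ∀ o ∈ Finset.range (2 * R + 1), ∑ E ∈ (Finset.range (R + 1)).biUnion
      (fun j => tailStars k j (c (i + o))), x ^ E.card ≤
      (∑ j ∈ Finset.range (R + 1), (Fintype.card V * x) ^ j) *
        ((Fintype.card V * x) ^ k / k.factorial) := by
    intro o _
    refine (Finset.sum_biUnion_le_of_forall_nonneg _ _ fun E => pow_nonneg hx _).trans ?_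
    rw [Finset.sum_mul]
    exact Finset.sum_le_sum fun j _ => sum_tailStars_le hx k j _
  refine (Finset.sum_le_sum h1).trans ?_
  rw [Finset.sum_const, Finset.card_range, nsmul_eq_mul, ← mul_assoc]
  push_cast
  exact le_rfl

namespace IsShortestCycle

variable {V : Type*} {F : SimpleGraph V} {l : ℕ} {c : ℕ → V}

theorem card_cycleEdges [DecidableEq V] (h : IsShortestCycle F l c) :
    (cycleEdges c l).card = l := by
  have h3 := h.three_le
  rw [cycleEdges, Finset.card_image_of_injOn, Finset.card_range]
  intro i hi j hj hij
  rw [Finset.coe_range, Set.mem_Iio] at hi hj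
  rcases Sym2.eq_iff.1 hij with ⟨h1, -⟩ | ⟨h1, h2⟩
  · exact ((h.eq_iff _ _).1 h1).eq_of_lt_of_lt hi hj
  · exfalso
    have e1 := (h.eq_iff _ _).1 h1
    have e2 := ((h.eq_iff _ _).1 h2).symm.trans (e1.add_right 1)
    have e3 : 0 ≡ 2 [MOD l] := Nat.ModEq.add_left_cancel' j e2
    exact absurd (e3.eq_of_lt_of_lt (by omega) (by omega)) (by omega)

theorem le_card [Fintype V] (h : IsShortestCycle F l c) : l ≤ Fintype.card V := by
  have hinj : Function.Injective fun i : Fin l => c i := fun i j hij =>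
    Fin.ext (((h.eq_iff _ _).1 hij).eq_of_lt_of_lt i.2 j.2)
  simpa using Fintype.card_le_of_injective _ hinj

end IsShortestCycle

/-- Union bound over the cycle and, independently for each of the attached stars, over its
position and its edge set; edge-disjointness makes the probabilities multiply. -/
theorem measureReal_hubHull_not_isAcyclic_le {V : Type*} [Fintype V] (p : unitInterval)
    (k R : ℕ) (hR : 1 ≤ R) :
    (SimpleGraph.binomialRandom V p).real {G | ¬ (hubHull G (k + R + 2) R).IsAcyclic} ≤
      ∑ m ∈ Finset.range (Fintype.card V), (Fintype.card V * p : ℝ) ^ (m + 3) *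
        ((2 * R + 1) * (∑ j ∈ Finset.range (R + 1), (Fintype.card V * p : ℝ) ^ j) *
          ((Fintype.card V * p : ℝ) ^ k / k.factorial)) ^ ((m + 3) / (2 * (2 * R + 3)) + 1) := by
  classical
  have hp0 : (0 : ℝ) ≤ p := p.2.1
  set δ : ℝ := (2 * R + 1) * (∑ j ∈ Finset.range (R + 1), (Fintype.card V * p : ℝ) ^ j) *
    ((Fintype.card V * p : ℝ) ^ k / k.factorial) with hδ
  set s := 2 * R + 3 with hs
  -- A cycle of length `m + 3` is encoded by its vertices `f`, continued periodically.
  let cyc : (m : ℕ) → (Fin (m + 3) → V) → ℕ → V := fun m f i => f (Fin.ofNat (m + 3) i)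
  -- These are the admissible families of attached stars for a given cycle.
  let T : (m : ℕ) → (Fin (m + 3) → V) →
      Finset (Fin ((m + 3) / (2 * s) + 1) → Finset (Sym2 V)) := fun m f =>
    (Fintype.piFinset fun i : Fin _ => attachedStars k R (cyc m f) (i * s)).filter fun E =>
      (cycleEdges (cyc m f) (m + 3)).card = m + 3 ∧
      (∀ i, Disjoint (E i) (cycleEdges (cyc m f) (m + 3))) ∧
      Pairwise fun i j => Disjoint (E i) (E j)
  let Ev : (m : ℕ) → (f : Fin (m + 3) → V) →
      (Fin ((m + 3) / (2 * s) + 1) → Finset (Sym2 V)) → Set (SimpleGraph V) := fun m f E =>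
    {G | ∀ e ∈ cycleEdges (cyc m f) (m + 3) ∪ Finset.univ.biUnion E, e ∈ G.edgeSet}
  have hsub : {G : SimpleGraph V | ¬ (hubHull G (k + R + 2) R).IsAcyclic} ⊆
      ⋃ m ∈ Finset.range (Fintype.card V), ⋃ f ∈ (Finset.univ : Finset (Fin (m + 3) → V)),
        ⋃ E ∈ T m f, Ev m f E := by
    intro G hG
    obtain ⟨l, c, hc, E, hE₁, hE₂, hE₃, hE₄⟩ := exists_cycle_with_attachedStars (k := k) (R := R)
      hG fun u v huv => exists_degreeGE_hubHull hR huv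
    have h3 := hc.three_le
    have hcard := hc.le_card
    obtain ⟨m, rfl⟩ : ∃ m, l = m + 3 := ⟨l - 3, by omega⟩
    have hcyc : cyc m (fun i => c i) = c := by
      funext i
      exact (hc.eq_iff _ _).2 (Nat.mod_modEq _ _)
    simp only [Set.mem_iUnion]
    refine ⟨m, Finset.mem_range.2 (by omega), fun i => c i, Finset.mem_univ _, E, ?_, ?_⟩
    · simp only [T, Finset.mem_filter, Fintype.mem_piFinset, hcyc]
      exact ⟨hE₁, hc.card_cycleEdges, hE₂, hE₃⟩
    · simp only [Ev, hcyc, Set.mem_ofPred_eq, Finset.mem_union, Finset.mem_biUnion,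
        Finset.mem_univ, true_and]
      rintro e (he | ⟨i, he⟩)
      · exact SimpleGraph.edgeSet_mono (hubHull_le _ _ _) (hc.cycleEdges_subset he)
      · exact SimpleGraph.edgeSet_mono (hubHull_le _ _ _) (hE₄ i e he)
  have hEv : ∀ m f, ∀ E ∈ T m f, (SimpleGraph.binomialRandom V p).real (Ev m f E) ≤
      (p : ℝ) ^ (m + 3) * ∏ i, (p : ℝ) ^ (E i).card := by
    intro m f E hE
    obtain ⟨-, hcard, hdisj, hpair⟩ := Finset.mem_filter.1 hE
    refine (measureReal_edges_subset_le p _).trans (le_of_eq ?_)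
    rw [Finset.card_union_of_disjoint, hcard, Finset.card_biUnion fun i _ j _ hij => hpair hij,
      pow_add, Finset.prod_pow_eq_pow_sum]
    exact (Finset.disjoint_biUnion_right _ _ _).2 fun i _ => (hdisj i).symm
  have hfsum : ∀ m (f : Fin (m + 3) → V), ∑ E ∈ T m f, (p : ℝ) ^ (m + 3) *
      ∏ i, (p : ℝ) ^ (E i).card ≤ (p : ℝ) ^ (m + 3) * δ ^ ((m + 3) / (2 * s) + 1) := by
    intro m f
    rw [← Finset.mul_sum]
    refine mul_le_mul_of_nonneg_left ?_ (pow_nonneg hp0 _)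
    refine (Finset.sum_le_sum_of_subset_of_nonneg (Finset.filter_subset _ _)
      fun _ _ _ => Finset.prod_nonneg fun _ _ => pow_nonneg hp0 _).trans ?_
    rw [← Finset.prod_univ_sum (fun i : Fin ((m + 3) / (2 * s) + 1) =>
      attachedStars k R (cyc m f) (i * s)) fun _ E => (p : ℝ) ^ E.card]
    refine (Finset.prod_le_prod (fun i _ => Finset.sum_nonneg fun _ _ => pow_nonneg hp0 _)
      fun i _ => sum_attachedStars_le hp0 k R _ _).trans ?_
    rw [Finset.prod_const, Finset.card_univ, Fintype.card_fin]
  refine (MeasureTheory.measureReal_mono hsub (MeasureTheory.measure_ne_top _ _)).trans ?_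
  refine (MeasureTheory.measureReal_biUnion_finset_le _ _).trans (Finset.sum_le_sum fun m _ => ?_)
  refine (MeasureTheory.measureReal_biUnion_finset_le _ _).trans ?_
  refine (Finset.sum_le_sum fun f _ => (MeasureTheory.measureReal_biUnion_finset_le _ _).trans
    ((Finset.sum_le_sum (hEv m f)).trans (hfsum m f))).trans ?_
  rw [Finset.sum_const, Finset.card_univ, Fintype.card_fun, Fintype.card_fin, nsmul_eq_mul,
    mul_pow]
  push_cast
  exact le_of_eq (by ring)

open Filter in
/-- For `n p = d` fixed, the part of the random graph close to the vertices of degree at least `D`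
is a forest with probability arbitrarily close to `1`, uniformly in `n`, if `D` is large. -/
theorem exists_measureReal_hubHull_not_isAcyclic_le {d : ℝ} (hd : 0 < d) (R : ℕ) (hR : 1 ≤ R)
    {ε : ℝ} (hε : 0 < ε) : ∃ D > 0, ∀ (n : ℕ) (p : unitInterval), (n * p : ℝ) = d →
      (SimpleGraph.binomialRandom (Fin n) p).real {G | ¬ (hubHull G D R).IsAcyclic} ≤ ε := by
  set s := 2 * R + 3 with hs
  -- `η` makes the geometric series with ratio `d * η` small.
  obtain ⟨η, hη0, hη1, hη2⟩ : ∃ η : ℝ, 0 < η ∧ d * η ≤ 1 / 2 ∧ d * η ≤ ε / 2 ∧ η ≤ 1 := by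
    refine ⟨min (1 / (2 * d)) (min (ε / (2 * d)) 1), by positivity, ?_, ?_, ?_⟩
    · calc d * _ ≤ d * (1 / (2 * d)) := mul_le_mul_of_nonneg_left (min_le_left _ _) hd.le
        _ = 1 / 2 := by field_simp
    · calc d * _ ≤ d * (ε / (2 * d)) := mul_le_mul_of_nonneg_left
            ((min_le_right _ _).trans (min_le_left _ _)) hd.le
        _ = ε / 2 := by field_simp
    · exact (min_le_right _ _).trans (min_le_right _ _)
  obtain ⟨hη2, hη3⟩ := hη2
  have hlim : Tendsto (fun k : ℕ => (2 * R + 1) * (∑ j ∈ Finset.range (R + 1), d ^ j) *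
      (d ^ k / k.factorial)) atTop (nhds 0) := by
    simpa using (FloorSemiring.tendsto_pow_div_factorial_atTop d).const_mul
      ((2 * R + 1) * (∑ j ∈ Finset.range (R + 1), d ^ j))
  obtain ⟨k, hk⟩ := (hlim.eventually (gt_mem_nhds (show 0 < η ^ (2 * s) by positivity))).exists
  refine ⟨k + R + 2, by omega, fun n p hnp => ?_⟩
  refine (measureReal_hubHull_not_isAcyclic_le p k R hR).trans ?_
  rw [Fintype.card_fin, hnp]
  set δ : ℝ := (2 * R + 1) * (∑ j ∈ Finset.range (R + 1), d ^ j) * (d ^ k / k.factorial) with hδ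
  have hδ0 : 0 ≤ δ := by positivity
  have hterm : ∀ m ∈ Finset.range n, d ^ (m + 3) * δ ^ ((m + 3) / (2 * s) + 1) ≤
      (d * η) * (1 / 2) ^ m := by
    intro m _
    have h1 : δ ^ ((m + 3) / (2 * s) + 1) ≤ η ^ (m + 3) := by
      refine (pow_le_pow_left₀ hδ0 hk.le _).trans ?_
      rw [← pow_mul]
      exact pow_le_pow_of_le_one hη0.le hη3 (Nat.lt_mul_div_succ (m + 3) (by omega)).le
    have h0 : 0 ≤ d * η := by positivity
    calc d ^ (m + 3) * δ ^ ((m + 3) / (2 * s) + 1) ≤ d ^ (m + 3) * η ^ (m + 3) :=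
          mul_le_mul_of_nonneg_left h1 (by positivity)
      _ = (d * η) * ((d * η) ^ m * (d * η) ^ 2) := by rw [← mul_pow]; ring
      _ ≤ (d * η) * ((1 / 2) ^ m * 1) := by
          refine mul_le_mul_of_nonneg_left ?_ h0
          exact mul_le_mul (pow_le_pow_left₀ h0 hη1 m) (pow_le_one₀ h0 (by linarith))
            (by positivity) (by positivity)
      _ = _ := by ring
  refine (Finset.sum_le_sum hterm).trans ?_
  rw [← Finset.mul_sum]
  have hgeom : ∑ m ∈ Finset.range n, (1 / 2 : ℝ) ^ m ≤ 2 := sum_geometric_two_le n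
  have h0 : 0 ≤ d * η := by positivity
  nlinarith

/-! ### The chromatic number of powers of sparse random graphs -/

theorem DegreeGE.le_maxDegree_graphPower {V : Type*} [Fintype V] {G : SimpleGraph V} {K r : ℕ}
    (hr : 1 ≤ r) {v : V} (h : DegreeGE G K v) : K ≤ (graphPower G r).maxDegree := by
  classical
  obtain ⟨L, rfl, hL⟩ := h
  refine le_trans ?_ ((graphPower G r).degree_le_maxDegree v)
  rw [← SimpleGraph.card_neighborFinset_eq_degree]
  refine Finset.card_le_card fun l hl => ?_
  rw [SimpleGraph.mem_neighborFinset]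
  exact ⟨(hL l hl).ne, (hL l hl).toWalk, by simpa using hr⟩

theorem theorem3 (d : ℝ) (hd : 0 < d) (r : ℕ) (hr : 2 ≤ r)
    (p : ℕ → unitInterval) (hp : ∀ᶠ n : ℕ in Filter.atTop, (p n : ℝ) = d / (n : ℝ)) :
    Filter.Tendsto
      (fun n : ℕ => SimpleGraph.binomialRandom (Fin n) (p n)
        {G : SimpleGraph (Fin n) |
          ((graphPower G (r / 2)).maxDegree : ℕ∞) ≤ (graphPower G r).chromaticNumber ∧
          (graphPower G r).chromaticNumber ≤ ((graphPower G (r - 1)).maxDegree : ℕ∞) + 1})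
      Filter.atTop (nhds 1) := by
  set S : (n : ℕ) → Set (SimpleGraph (Fin n)) := fun n => {G : SimpleGraph (Fin n) |
    ((graphPower G (r / 2)).maxDegree : ℕ∞) ≤ (graphPower G r).chromaticNumber ∧
    (graphPower G r).chromaticNumber ≤ ((graphPower G (r - 1)).maxDegree : ℕ∞) + 1} with hS
  suffices h : Filter.Tendsto (fun n : ℕ => (SimpleGraph.binomialRandom (Fin n) (p n)).real (S n))
      Filter.atTop (nhds 1) by
    have h1 := ENNReal.tendsto_ofReal h
    simpa [MeasureTheory.ofReal_measureReal] using h1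
  rw [Metric.tendsto_nhds]
  intro ε hε
  obtain ⟨D, hD, hDε⟩ := exists_measureReal_hubHull_not_isAcyclic_le hd (2 * r) (by omega)
    (half_pos hε)
  have hdeg := tendsto_measureReal_no_degreeGE hd hp (K := D ^ r) (by positivity)
  filter_upwards [hp, Filter.eventually_gt_atTop 0, hdeg.eventually (gt_mem_nhds (half_pos hε))]
    with n hpn hn hdegn
  have hn0 : (n : ℝ) ≠ 0 := by exact_mod_cast hn.ne'
  have hcyc := hDε n (p n) (by rw [hpn]; field_simp)
  have hcover : (Set.univ : Set (SimpleGraph (Fin n))) ⊆ S n ∪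
      ({G | ¬ (hubHull G D (2 * r)).IsAcyclic} ∪ {G | ∀ v, ¬ DegreeGE G (D ^ r) v}) := by
    intro G _
    by_cases hF : (hubHull G D (2 * r)).IsAcyclic
    · by_cases hK : ∀ v, ¬ DegreeGE G (D ^ r) v
      · exact .inr (.inr hK)
      · push Not at hK
        obtain ⟨v, hv⟩ := hK
        exact .inl ⟨maxDegree_graphPower_half_le_chromaticNumber G r,
          chromaticNumber_graphPower_le G r D hr hF (hv.le_maxDegree_graphPower (by omega))⟩
    · exact .inr (.inl hF)
  have h1 := (MeasureTheory.measureReal_mono (μ := SimpleGraph.binomialRandom (Fin n) (p n))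
    hcover).trans ((MeasureTheory.measureReal_union_le _ _).trans
      (add_le_add_right (MeasureTheory.measureReal_union_le _ _) _))
  rw [MeasureTheory.probReal_univ] at h1
  have h2 : (SimpleGraph.binomialRandom (Fin n) (p n)).real (S n) ≤ 1 :=
    MeasureTheory.measureReal_le_one
  rw [Real.dist_eq, abs_sub_comm, abs_of_nonneg (by linarith)]
  linarith
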